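/- **Notation.** Let $\mathbb H$ be the quaternions, $\mathbb S=\{I\in\mathbb H: I^2=-1\}$, and let $\mathbb C\otimes\mathbb H=\{v_0+\sqrt{-1}\,v_1: v_0,v_1\in\mathbb H\}$ be the complexified algebra, with product $(v_0+\sqrt{-1}v_1)(w_0+\sqrt{-1}w_1)=v_0w_0-v_1w_1+\sqrt{-1}(v_0w_1+v_1w_0)$ and conjugation $\overline{v_0+\sqrt{-1}v_1}=v_0-\sqrt{-1}v_1$. It is identified with $\mathbb C^4$ by writing its elements as $z_0+z_1i+z_2j+z_3k$ with $z_0,\dots,z_3\in\mathbb C$, and $\mathbb H$ is embedded as $\{v_0+\sqrt{-1}\cdot 0\}$. Let $\sigma_k(w)=w^k$ on $\mathbb C\otimes\mathbb H$, and $$\Omega=\{z\in\mathbb C^4:\ z_1^2+z_2^2+z_3^2\neq0,\ z_0^2+z_1^2+z_2^2+z_3^2\neq 0,\ z_0\neq 0\}.$$ Let $\mathcal U\subseteq\mathbb C$ be open and symmetric with respect to the real axis, and $U=\{\alpha+I\beta:\alpha+\imath\beta\in\mathcal U,\ I\in\mathbb S\}$. A stem function is a map $F=F_0+\sqrt{-1}F_1:\mathcal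 U\to\mathbb C\otimes\mathbb H$ with $F(\bar z)=\overline{F(z)}$; it induces the slice function $f=\mathcal I(F):U\to\mathbb H$, $f(\alpha+I\beta)=F_0(\alpha+\imath\beta)+I\,F_1(\alpha+\imath\beta)$. The function $f$ is slice regular if $F$ is holomorphic. The $\star$-product is $\mathcal I(F)\star\mathcal I(G)=\mathcal I(FG)$, and $g^{\star k}$ is the $k$-th power for it. A lift of $F$ through $\sigma_k$ is a continuous map $G:\mathcal U\to\mathbb C\otimes\mathbb H$ with $\sigma_k\circ G=F$. **Theorem.** Let $k\ge 1$, let $\mathcal U\subseteq\mathbb C$ be open, simply connected, symmetric with respect to the real axis, with $\mathcal U\cap\mathbb R\neq\emptyset$, and let $f=\mathcal I(F):U\to\mathbb H$ be a slice function with $F(\mathcal U)\subseteq\Omega$. Then: 1. There are $k$ pairwise distinct slice functions $f_1,\dots,f_k:U\to\mathbb H$ with $(f_m)^{\star k}=f$ for all $m$. 2. Suppose that $F$ is continuous and let $x^0\in\mathcal U\cap\mathbb R$. Then $F(x^0)=q_0\in\mathbb H$, and $q_0$ has exactly $k$ distinct $k$-th roots $q_1,\dots,q_k$ in $\mathbb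 H$. For each $m$ there is exactly one lift $F_m$ of $F$ through $\sigma_k$ with $F_m(x^0)=q_m$. Each $F_m$ is a stem function, and the slice functions $f_m=\mathcal I(F_m)$ are pairwise distinct and satisfy $(f_m)^{\star k}=f$. If moreover $f$ is slice regular, then every $F_m$ is holomorphic and every $f_m$ is slice regular. 3. In particular, if $f$ is slice regular, there are $k$ pairwise distinct slice regular functions $f_1,\dots,f_k:U\to\mathbb H$ with $(f_m)^{\star k}=f$ for all $m$. -/

import Mathlib

open scoped Quaternion

noncomputable section

namespace SliceRoots

/-! ### The algebra of complexified quaternions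

The algebra `ℂ ⊗ ℍ` is `ℍ[ℂ]`, the quaternions with complex coefficients; its element
`z₀ + z₁ i + z₂ j + z₃ k` is `v₀ + √-1 v₁`, where the quaternions `v₀` and `v₁` collect the real
and the imaginary parts of the coefficients. -/

/-- The quaternion `v₀` of `w = v₀ + √-1 v₁`. -/
def rePart (w : ℍ[ℂ]) : ℍ[ℝ] := ⟨w.re.re, w.imI.re, w.imJ.re, w.imK.re⟩

/-- The quaternion `v₁` of `w = v₀ + √-1 v₁`. -/
def imPart (w : ℍ[ℂ]) : ℍ[ℝ] := ⟨w.re.im, w.imI.im, w.imJ.im, w.imK.im⟩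

@[simp] theorem rePart_re (w : ℍ[ℂ]) : (rePart w).re = w.re.re := rfl
@[simp] theorem rePart_imI (w : ℍ[ℂ]) : (rePart w).imI = w.imI.re := rfl
@[simp] theorem rePart_imJ (w : ℍ[ℂ]) : (rePart w).imJ = w.imJ.re := rfl
@[simp] theorem rePart_imK (w : ℍ[ℂ]) : (rePart w).imK = w.imK.re := rfl
@[simp] theorem imPart_re (w : ℍ[ℂ]) : (imPart w).re = w.re.im := rfl
@[simp] theorem imPart_imI (w : ℍ[ℂ]) : (imPart w).imI = w.imI.im := rfl
@[simp] theorem imPart_imJ (w : ℍ[ℂ]) : (imPart w).imJ = w.imJ.im := rfl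
@[simp] theorem imPart_imK (w : ℍ[ℂ]) : (imPart w).imK = w.imK.im := rfl

/-- The product of `ℍ[ℂ]` is the product of the complexification `ℂ ⊗ ℍ`: real part. -/
theorem rePart_mul (v w : ℍ[ℂ]) :
    rePart (v * w) = rePart v * rePart w - imPart v * imPart w := by
  ext <;> simp <;> ring

/-- The product of `ℍ[ℂ]` is the product of the complexification `ℂ ⊗ ℍ`: imaginary part. -/
theorem imPart_mul (v w : ℍ[ℂ]) :
    imPart (v * w) = rePart v * imPart w + imPart v * rePart w := by
  ext <;> simp <;> ring

/-- The inclusion `p ↦ 1 ⊗ p = p + √-1 · 0` of `ℍ`; its image is the set of real points. -/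
def ofQuat (p : ℍ[ℝ]) : ℍ[ℂ] := ⟨(p.re : ℂ), (p.imI : ℂ), (p.imJ : ℂ), (p.imK : ℂ)⟩

/-- The complex conjugation `v₀ + √-1 v₁ ↦ v₀ - √-1 v₁` (not the quaternionic one). -/
def cconj (w : ℍ[ℂ]) : ℍ[ℂ] :=
  ⟨starRingEnd ℂ w.re, starRingEnd ℂ w.imI, starRingEnd ℂ w.imJ, starRingEnd ℂ w.imK⟩

@[simp] theorem cconj_re (w : ℍ[ℂ]) : (cconj w).re = starRingEnd ℂ w.re := rfl
@[simp] theorem cconj_imI (w : ℍ[ℂ]) : (cconj w).imI = starRingEnd ℂ w.imI := rfl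
@[simp] theorem cconj_imJ (w : ℍ[ℂ]) : (cconj w).imJ = starRingEnd ℂ w.imJ := rfl
@[simp] theorem cconj_imK (w : ℍ[ℂ]) : (cconj w).imK = starRingEnd ℂ w.imK := rfl

/-- The identification of `ℂ ⊗ ℍ` with `ℂ⁴`, through which topology and holomorphy on `ℂ ⊗ ℍ`
are understood. -/
def phi : ℍ[ℂ] ≃ (Fin 4 → ℂ) := Quaternion.equivTuple ℂ

/-- The `k`-th power map of `ℂ ⊗ ℍ`. -/
def sigma (k : ℕ) (w : ℍ[ℂ]) : ℍ[ℂ] := w ^ k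

/-- The complex quadratic form `z₁² + z₂² + z₃²` of the vector part. -/
def vecNorm (w : ℍ[ℂ]) : ℂ := w.imI ^ 2 + w.imJ ^ 2 + w.imK ^ 2

/-- The set `Ω` of points with `z₁² + z₂² + z₃² ≠ 0`, `z₀² + z₁² + z₂² + z₃² ≠ 0` and `z₀ ≠ 0`. -/
def Omega : Set ℍ[ℂ] := {w | vecNorm w ≠ 0 ∧ w.re ^ 2 + vecNorm w ≠ 0 ∧ w.re ≠ 0}

/-- Continuity on `D` of a map into `ℂ ⊗ ℍ ≃ ℂ⁴`. -/
def ContOn (D : Set ℂ) (F : ℂ → ℍ[ℂ]) : Prop := ContinuousOn (fun z => phi (F z)) D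

/-- Holomorphy on the open set `D` of a map into `ℂ ⊗ ℍ ≃ ℂ⁴`. -/
def HolOn (D : Set ℂ) (F : ℂ → ℍ[ℂ]) : Prop := DifferentiableOn ℂ (fun z => phi (F z)) D

/-! ### Slice functions -/

/-- The sphere of imaginary units of `ℍ`. -/
def imagUnits : Set ℍ[ℝ] := {I | I * I = -1}

/-- The map `π(α + i β, I) = α + I β`. -/
def piC (z : ℂ) (I : ℍ[ℝ]) : ℍ[ℝ] := (z.re : ℍ[ℝ]) + I * (z.im : ℍ[ℝ])

/-- The map `π(v₀ + √-1 v₁, I) = v₀ + I v₁`. -/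
def piH (w : ℍ[ℂ]) (I : ℍ[ℝ]) : ℍ[ℝ] := rePart w + I * imPart w

/-- The circular set `U = π(D × 𝕊)`. -/
def circ (D : Set ℂ) : Set ℍ[ℝ] := {q | ∃ z ∈ D, ∃ I ∈ imagUnits, piC z I = q}

/-- `F` is a stem function on `D`. The equation `F (conj z) = conj (F z)` presupposes that `D` is
symmetric with respect to the real axis, which is made explicit. Only the values of `F` on `D`
matter. -/
def IsStem (D : Set ℂ) (F : ℂ → ℍ[ℂ]) : Prop :=
  ∀ z ∈ D, starRingEnd ℂ z ∈ D ∧ F (starRingEnd ℂ z) = cconj (F z)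

/-- `f` is induced by `F`: `f (π(z, I)) = π(F z, I)` for `z ∈ D` and `I ∈ 𝕊`. -/
def Induces (D : Set ℂ) (F : ℂ → ℍ[ℂ]) (f : circ D → ℍ[ℝ]) : Prop :=
  ∀ (z : ℂ) (hz : z ∈ D) (I : ℍ[ℝ]) (hI : I ∈ imagUnits),
    f ⟨piC z I, z, hz, I, hI, rfl⟩ = piH (F z) I

/-- `f` is a slice function. -/
def IsSlice (D : Set ℂ) (f : circ D → ℍ[ℝ]) : Prop :=
  ∃ F : ℂ → ℍ[ℂ], IsStem D F ∧ Induces D F f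

/-- `f` is a slice regular function. -/
def IsSliceRegular (D : Set ℂ) (f : circ D → ℍ[ℝ]) : Prop :=
  ∃ F : ℂ → ℍ[ℂ], IsStem D F ∧ HolOn D F ∧ Induces D F f

/-- The function `𝓘(F)` with `𝓘(F)(π(z, I)) = π(F z, I)`; for a stem function `F` the value does
not depend on the chosen `z` and `I`, see `induces_sliceFn`. -/
def sliceFn (D : Set ℂ) (F : ℂ → ℍ[ℂ]) : circ D → ℍ[ℝ] := fun q =>
  piH (F q.2.choose) q.2.choose_spec.2.choose

open Classical in
/-- The stem function of a slice function (unique on `D`, see `stem_unique`). -/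
def stemOf (D : Set ℂ) (f : circ D → ℍ[ℝ]) : ℂ → ℍ[ℂ] :=
  if h : IsSlice D f then h.choose else 0

/-- The `⋆`-product `𝓘(F) ⋆ 𝓘(G) = 𝓘(F G)` of slice functions. -/
def starMul (D : Set ℂ) (f g : circ D → ℍ[ℝ]) : circ D → ℍ[ℝ] :=
  sliceFn D (fun z => stemOf D f z * stemOf D g z)

/-- The `k`-th `⋆`-power of a slice function. -/
def starPow (D : Set ℂ) (f : circ D → ℍ[ℝ]) : ℕ → (circ D → ℍ[ℝ])
  | 0 => fun _ => 1
  | k + 1 => starMul D (starPow D f k) f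

/-- `G` is a (continuous) lift of `F` through `σ_k` on `D`. -/
def IsLift (D : Set ℂ) (k : ℕ) (F G : ℂ → ℍ[ℂ]) : Prop :=
  ContOn D G ∧ ∀ z ∈ D, sigma k (G z) = F z

/-! ### The definitions above are meaningful -/

theorem imagUnits_re {I : ℍ[ℝ]} (hI : I ∈ imagUnits) :
    I.re = 0 ∧ I.imI ^ 2 + I.imJ ^ 2 + I.imK ^ 2 = 1 := by
  have h : I * I = -1 := hI
  have h0 := congrArg QuaternionAlgebra.re h
  have h1 := congrArg QuaternionAlgebra.imI h
  have h2 := congrArg QuaternionAlgebra.imJ h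
  have h3 := congrArg QuaternionAlgebra.imK h
  simp at h0 h1 h2 h3
  have hr : I.re = 0 := by
    by_contra hne
    have e1 : I.imI = 0 := by
      have : I.re * I.imI = 0 := by linarith
      simpa [hne] using this
    have e2 : I.imJ = 0 := by
      have : I.re * I.imJ = 0 := by linarith
      simpa [hne] using this
    have e3 : I.imK = 0 := by
      have : I.re * I.imK = 0 := by linarith
      simpa [hne] using this
    rw [e1, e2, e3] at h0
    nlinarith [sq_nonneg I.re]
  refine ⟨hr, ?_⟩
  rw [hr] at h0
  linarith

theorem piC_eq {z w : ℂ} {I J : ℍ[ℝ]} (hI : I ∈ imagUnits) (hJ : J ∈ imagUnits)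
    (h : piC z I = piC w J) :
    z.re = w.re ∧ ((z.im = w.im ∧ (z.im = 0 ∨ I = J)) ∨ (z.im = -w.im ∧ I = -J)) := by
  obtain ⟨hI0, hI1⟩ := imagUnits_re hI
  obtain ⟨hJ0, hJ1⟩ := imagUnits_re hJ
  have h0 := congrArg QuaternionAlgebra.re h
  have h1 := congrArg QuaternionAlgebra.imI h
  have h2 := congrArg QuaternionAlgebra.imJ h
  have h3 := congrArg QuaternionAlgebra.imK h
  simp [piC, hI0, hJ0] at h0 h1 h2 h3
  refine ⟨h0, ?_⟩
  have hsq : z.im ^ 2 = w.im ^ 2 := by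
    calc z.im ^ 2 = (I.imI * z.im) ^ 2 + (I.imJ * z.im) ^ 2 + (I.imK * z.im) ^ 2 := by
          linear_combination (-z.im ^ 2) * hI1
      _ = (J.imI * w.im) ^ 2 + (J.imJ * w.im) ^ 2 + (J.imK * w.im) ^ 2 := by rw [h1, h2, h3]
      _ = w.im ^ 2 := by linear_combination (w.im ^ 2) * hJ1
  by_cases hz : z.im = 0
  · left
    have : w.im = 0 := by
      have : w.im ^ 2 = 0 := by rw [← hsq, hz]; ring
      simpa using this
    exact ⟨by rw [hz, this], Or.inl hz⟩
  · rcases sq_eq_sq_iff_eq_or_eq_neg.mp hsq with e | e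
    · left
      have hw : w.im ≠ 0 := by rwa [← e]
      rw [e] at h1 h2 h3
      refine ⟨e, Or.inr ?_⟩
      ext
      · rw [hI0, hJ0]
      · exact mul_right_cancel₀ hw h1
      · exact mul_right_cancel₀ hw h2
      · exact mul_right_cancel₀ hw h3
    · right
      have hw : w.im ≠ 0 := by
        intro h'
        exact hz (by rw [e, h', neg_zero])
      rw [e] at h1 h2 h3
      refine ⟨e, ?_⟩
      ext
      · simp [hI0, hJ0]
      · apply mul_right_cancel₀ hw
        simp
        linarith
      · apply mul_right_cancel₀ hw
        simp
        linarith
      · apply mul_right_cancel₀ hw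
        simp
        linarith

theorem rePart_cconj (w : ℍ[ℂ]) : rePart (cconj w) = rePart w := by
  ext <;> simp

theorem imPart_cconj (w : ℍ[ℂ]) : imPart (cconj w) = -imPart w := by
  ext <;> simp

/-- A stem function induces a well-defined slice function. -/
theorem induces_sliceFn {D : Set ℂ} {F : ℂ → ℍ[ℂ]} (hF : IsStem D F) :
    Induces D F (sliceFn D F) := by
  intro z hz I hI
  have key : ∀ (w : ℂ) (J : ℍ[ℝ]), w ∈ D → J ∈ imagUnits → piC w J = piC z I →
      piH (F w) J = piH (F z) I := by
    intro w J hw hJ h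
    obtain ⟨hre, ⟨him, h0⟩ | ⟨him, hneg⟩⟩ := piC_eq hJ hI h
    · have hwz : w = z := Complex.ext hre him
      subst hwz
      rcases h0 with h0 | h0
      · have hc : starRingEnd ℂ w = w := Complex.conj_eq_iff_im.mpr h0
        have h1 := (hF w hw).2
        rw [hc] at h1
        have h2 : imPart (F w) = -imPart (F w) := by
          conv_lhs => rw [h1]
          exact imPart_cconj _
        have h3 : imPart (F w) = 0 := by
          have h4 : (2 : ℝ) • imPart (F w) = 0 := by
            rw [two_smul]
            exact eq_neg_iff_add_eq_zero.mp h2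
          simpa using h4
        simp [piH, h3]
      · rw [h0]
    · have hwz : w = starRingEnd ℂ z := by
        apply Complex.ext <;> simp [hre, him]
      rw [hwz, (hF z hz).2, hneg]
      simp [piH, rePart_cconj, imPart_cconj]
  have hq : piC z I ∈ circ D := ⟨z, hz, I, hI, rfl⟩
  exact key _ _ hq.choose_spec.1 hq.choose_spec.2.choose_spec.1 hq.choose_spec.2.choose_spec.2

/-- The function induced by a given function is determined by it. -/
theorem Induces.unique {D : Set ℂ} {F : ℂ → ℍ[ℂ]} {f g : circ D → ℍ[ℝ]}
    (hf : Induces D F f) (hg : Induces D F g) : f = g := by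
  funext ⟨q, z, hz, I, hI, hq⟩
  subst hq
  rw [hf z hz I hI, hg z hz I hI]

/-- The stem function of a slice function is unique. -/
theorem stem_unique {D : Set ℂ} {F G : ℂ → ℍ[ℂ]} {f : circ D → ℍ[ℝ]}
    (hF : Induces D F f) (hG : Induces D G f) : Set.EqOn F G D := by
  intro z hz
  obtain ⟨i, hi0, hi1, hi2, hi3⟩ :
      ∃ i : ℍ[ℝ], i.re = 0 ∧ i.imI = 1 ∧ i.imJ = 0 ∧ i.imK = 0 := ⟨⟨0, 1, 0, 0⟩, rfl, rfl, rfl, rfl⟩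
  have hi : i ∈ imagUnits := by
    change i * i = -1
    ext <;> simp [hi0, hi1, hi2, hi3]
  have hi' : -i ∈ imagUnits := by
    change -i * -i = -1
    ext <;> simp [hi0, hi1, hi2, hi3]
  have h := (hF z hz _ hi).symm.trans (hG z hz _ hi)
  have h' := (hF z hz _ hi').symm.trans (hG z hz _ hi')
  have a0 := congrArg QuaternionAlgebra.re h
  have a1 := congrArg QuaternionAlgebra.imI h
  have a2 := congrArg QuaternionAlgebra.imJ h
  have a3 := congrArg QuaternionAlgebra.imK h
  have b0 := congrArg QuaternionAlgebra.re h'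
  have b1 := congrArg QuaternionAlgebra.imI h'
  have b2 := congrArg QuaternionAlgebra.imJ h'
  have b3 := congrArg QuaternionAlgebra.imK h'
  simp [piH, hi0, hi1, hi2, hi3] at a0 a1 a2 a3 b0 b1 b2 b3
  ext <;> apply Complex.ext <;> linarith

theorem Induces.congr {D : Set ℂ} {F G : ℂ → ℍ[ℂ]} {f : circ D → ℍ[ℝ]}
    (hF : Induces D F f) (h : Set.EqOn F G D) : Induces D G f := by
  intro z hz I hI
  rw [hF z hz I hI, h hz]

theorem IsStem.mul {D : Set ℂ} {F G : ℂ → ℍ[ℂ]} (hF : IsStem D F) (hG : IsStem D G) :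
    IsStem D (fun z => F z * G z) := by
  intro z hz
  refine ⟨(hF z hz).1, ?_⟩
  change F _ * G _ = cconj (F z * G z)
  rw [(hF z hz).2, (hG z hz).2]
  ext <;> simp

theorem stemOf_spec {D : Set ℂ} {f : circ D → ℍ[ℝ]} (hf : IsSlice D f) :
    IsStem D (stemOf D f) ∧ Induces D (stemOf D f) f := by
  rw [stemOf, dif_pos hf]
  exact hf.choose_spec

/-- The `⋆`-product of the functions induced by `F` and `G` is induced by `F G`. -/
theorem induces_starMul {D : Set ℂ} {F G : ℂ → ℍ[ℂ]} {f g : circ D → ℍ[ℝ]}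
    (hF : IsStem D F) (hf : Induces D F f) (hG : IsStem D G) (hg : Induces D G g) :
    Induces D (fun z => F z * G z) (starMul D f g) := by
  obtain ⟨sf, jf⟩ := stemOf_spec ⟨F, hF, hf⟩
  obtain ⟨sg, jg⟩ := stemOf_spec ⟨G, hG, hg⟩
  refine (induces_sliceFn (sf.mul sg)).congr ?_
  intro z hz
  change stemOf D f z * stemOf D g z = F z * G z
  rw [stem_unique jf hf hz, stem_unique jg hg hz]

/-- The `k`-th `⋆`-power of the function induced by `G` is induced by `σ_k ∘ G`. -/
theorem induces_starPow {D : Set ℂ} {G : ℂ → ℍ[ℂ]} {g : circ D → ℍ[ℝ]}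
    (hG : IsStem D G) (hg : Induces D G g) (k : ℕ) :
    IsStem D (fun z => sigma k (G z)) ∧ Induces D (fun z => sigma k (G z)) (starPow D g k) := by
  induction k with
  | zero =>
    constructor
    · intro z hz
      refine ⟨(hG z hz).1, ?_⟩
      ext <;> simp [sigma]
    · intro z hz I hI
      ext <;> simp [starPow, sigma, piH]
  | succ k ih =>
    have e : (fun z => sigma (k + 1) (G z)) = fun z => sigma k (G z) * G z := by
      funext z
      exact pow_succ _ _
    rw [e]
    exact ⟨ih.1.mul hG, induces_starMul ih.1 ih.2 hG hg⟩

end SliceRoots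

end

open SliceRoots

open scoped Quaternion

noncomputable section

namespace SliceRoots

/-! ### Continuous and holomorphic roots of complex functions -/

/-! For `w` in `Omega`, choose `t` with `t ^ 2 = vecNorm w`. The vector part of `w` divided by `t`
is a unit `J` with `J ^ 2 = -1`, and `ℂ[J]` is isomorphic to `ℂ × ℂ`, with `w` corresponding to the
pair `w.re ± i t`. A `k`-th root of `w` commutes with `w`, so its vector part is parallel to that of
`w` and it lies in `ℂ[J]`. Taking roots of `w` thus means taking roots of two complex numbers, which
are nonzero because their product is `w.re ^ 2 + vecNorm w` (`mix_eig`, `eig_pow`, `mix_pow_eq`).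

Over a simply connected `D`, the square root `t` and the roots of both eigenvalues can be chosen
continuously, and they are holomorphic when `F` is. This gives a lift with any prescribed initial
root (`exists_isLift`). Uniqueness (`IsLift.eqOn`) holds since two continuous roots of one
nonvanishing function differ by a locally constant root of unity.

At a real point a stem function takes a value in `ℍ`, here nonreal since `vecNorm ≠ 0`; its
quaternionic roots lie in a copy of `ℂ`, so there are exactly `k`. A lift starting at one of them
coincides with its reflection `z ↦ cconj (G (conj z))`, hence is a stem function. Without
continuity, roots are chosen pointwise and symmetrically (`exists_stem_roots`). -/

theorem exists_continuousOn_root {D : Set ℂ} (hDo : IsOpen D) (hDs : IsSimplyConnected D)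
    {a : ℂ → ℂ} (ha : ContinuousOn a D) (ha0 : ∀ z ∈ D, a z ≠ 0) {k : ℕ} (hk : k ≠ 0)
    {x : ℂ} (hx : x ∈ D) {α : ℂ} (hα : α ^ k = a x) :
    ∃ u : ℂ → ℂ, ContinuousOn u D ∧ (∀ z, u z ^ k = a z) ∧ u x = α := by
  obtain ⟨u, hu, huk⟩ := Complex.exists_continuousOn_pow_eq hDs hDo ha
    (by rintro ⟨z, hz, h⟩; exact ha0 z hz h) hk
  have hux : u x ≠ 0 := by
    intro h
    apply ha0 x hx
    rw [← huk, h, zero_pow hk]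
  -- Both `α` and `u x` are `k`-th roots of `a x`, so the constant factor is a `k`-th root of unity.
  refine ⟨fun z => u z * (α / u x), hu.mul continuousOn_const, fun z => ?_, ?_⟩
  · rw [mul_pow, div_pow, hα, huk, huk, div_self (ha0 x hx), mul_one]
  · field_simp

/-- The quotient `u / v` maps a preconnected set continuously into the finite, hence discrete, set
of `k`-th roots of unity, so it is constant. -/
theorem eqOn_of_pow_eq {D : Set ℂ} (hD : IsPreconnected D) {u v : ℂ → ℂ}
    (hu : ContinuousOn u D) (hv : ContinuousOn v D) {k : ℕ} (hk : k ≠ 0)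
    (h : ∀ z ∈ D, u z ^ k = v z ^ k) (hv0 : ∀ z ∈ D, v z ≠ 0)
    {x : ℂ} (hx : x ∈ D) (hux : u x = v x) : Set.EqOn u v D := by
  have hT : {ζ : ℂ | ζ ^ k = 1}.Finite := by
    refine (Polynomial.nthRootsFinset k (1 : ℂ)).finite_toSet.subset fun ζ hζ => ?_
    simpa [Polynomial.mem_nthRootsFinset (Nat.pos_of_ne_zero hk)] using hζ
  intro z hz
  have := hD.constant_of_mapsTo hT.isDiscrete (f := fun z => u z / v z) (hu.div hv hv0)
    (fun z hz => by
      change (u z / v z) ^ k = 1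
      rw [div_pow, h z hz, div_self (pow_ne_zero _ (hv0 z hz))]) hz hx
  simp only [hux, div_self (hv0 x hx)] at this
  exact (div_eq_one_iff_eq (hv0 z hz)).mp this

/-- Factor `u z ^ k - u x ^ k = S z * (u z - u x)`. Since `S x = k * u x ^ (k - 1)` is nonzero, the
slope of `u` is that of `a` divided by `S`, and continuity of `u` suffices to pass to the limit. -/
theorem differentiableOn_of_pow {D : Set ℂ} (hDo : IsOpen D) {u a : ℂ → ℂ}
    (hu : ContinuousOn u D) {k : ℕ} (hk : k ≠ 0) (h : ∀ z ∈ D, u z ^ k = a z)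
    (ha : DifferentiableOn ℂ a D) (ha0 : ∀ z ∈ D, a z ≠ 0) : DifferentiableOn ℂ u D := by
  intro x hx
  have hDx : D ∈ nhds x := hDo.mem_nhds hx
  have hux : u x ≠ 0 := fun h0 => ha0 x hx (by rw [← h x hx, h0, zero_pow hk])
  have hda := (ha.differentiableAt hDx).hasDerivAt
  rw [hasDerivAt_iff_tendsto_slope] at hda
  set S : ℂ → ℂ := fun z => ∑ i ∈ Finset.range k, u z ^ i * u x ^ (k - 1 - i) with hS
  have hSx : S x ≠ 0 := by
    rw [hS]
    simp only
    rw [geom_sum₂_self]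
    exact mul_ne_zero (Nat.cast_ne_zero.mpr hk) (pow_ne_zero _ hux)
  have hSc : ContinuousAt S x := by
    have := hu.continuousAt hDx
    fun_prop
  have hSt : Filter.Tendsto S (nhdsWithin x {x}ᶜ) (nhds (S x)) :=
    hSc.tendsto.mono_left nhdsWithin_le_nhds
  refine (HasDerivAt.differentiableAt (f' := deriv a x / S x) ?_).differentiableWithinAt
  rw [hasDerivAt_iff_tendsto_slope]
  refine (hda.div hSt hSx).congr' ?_
  filter_upwards [hSt.eventually_ne hSx, nhdsWithin_le_nhds hDx] with z hz hzD
  have hg := geom_sum₂_mul (u z) (u x) k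
  rw [h z hzD, h x hx] at hg
  simp only [Pi.div_apply, slope_def_field, ← hg]
  change S z * (u z - u x) / (z - x) / S z = _
  field_simp

/-! ### Coordinates -/

theorem contOn_iff {D : Set ℂ} {F : ℂ → ℍ[ℂ]} : ContOn D F ↔
    ContinuousOn (fun z => (F z).re) D ∧ ContinuousOn (fun z => (F z).imI) D ∧
    ContinuousOn (fun z => (F z).imJ) D ∧ ContinuousOn (fun z => (F z).imK) D := by
  simp only [ContOn, continuousOn_pi, Fin.forall_fin_succ, IsEmpty.forall_iff, and_true]
  rfl

theorem holOn_iff {D : Set ℂ} {F : ℂ → ℍ[ℂ]} : HolOn D F ↔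
    DifferentiableOn ℂ (fun z => (F z).re) D ∧ DifferentiableOn ℂ (fun z => (F z).imI) D ∧
    DifferentiableOn ℂ (fun z => (F z).imJ) D ∧ DifferentiableOn ℂ (fun z => (F z).imK) D := by
  simp only [HolOn, differentiableOn_pi, Fin.forall_fin_succ, IsEmpty.forall_iff, and_true]
  rfl

theorem HolOn.contOn {D : Set ℂ} {F : ℂ → ℍ[ℂ]} (h : HolOn D F) : ContOn D F :=
  DifferentiableOn.continuousOn h

theorem HolOn.congr {D : Set ℂ} {F G : ℂ → ℍ[ℂ]} (h : HolOn D F) (e : Set.EqOn F G D) :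
    HolOn D G :=
  DifferentiableOn.congr h fun z hz => by rw [e hz]

/-! ### The two copies of `ℂ` in the algebra generated by an imaginary unit -/

/-- The element of `ℂ[J] ≃ ℂ × ℂ` with eigenvalues `a` and `b`, where `J ^ 2 = -1`. -/
def mix (J : ℍ[ℂ]) (a b : ℂ) : ℍ[ℂ] :=
  ⟨(a + b) / 2, -Complex.I * (a - b) / 2 * J.imI, -Complex.I * (a - b) / 2 * J.imJ,
    -Complex.I * (a - b) / 2 * J.imK⟩

@[simp] theorem mix_re (J : ℍ[ℂ]) (a b : ℂ) : (mix J a b).re = (a + b) / 2 := rfl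
@[simp] theorem mix_imI (J : ℍ[ℂ]) (a b : ℂ) :
    (mix J a b).imI = -Complex.I * (a - b) / 2 * J.imI := rfl
@[simp] theorem mix_imJ (J : ℍ[ℂ]) (a b : ℂ) :
    (mix J a b).imJ = -Complex.I * (a - b) / 2 * J.imJ := rfl
@[simp] theorem mix_imK (J : ℍ[ℂ]) (a b : ℂ) :
    (mix J a b).imK = -Complex.I * (a - b) / 2 * J.imK := rfl

/-- The bilinear form associated with `vecNorm`. -/
def vecDot (v w : ℍ[ℂ]) : ℂ := v.imI * w.imI + v.imJ * w.imJ + v.imK * w.imK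

/-- The first eigenvalue of an element of `ℂ[J]`. -/
def eigFst (J w : ℍ[ℂ]) : ℂ := w.re + Complex.I * vecDot J w

/-- The second eigenvalue of an element of `ℂ[J]`. -/
def eigSnd (J w : ℍ[ℂ]) : ℂ := w.re - Complex.I * vecDot J w

/-- The vector part of `w`, divided by `t`. -/
def unitVec (t : ℂ) (w : ℍ[ℂ]) : ℍ[ℂ] := ⟨0, w.imI / t, w.imJ / t, w.imK / t⟩

@[simp] theorem unitVec_imI (t : ℂ) (w : ℍ[ℂ]) : (unitVec t w).imI = w.imI / t := rfl
@[simp] theorem unitVec_imJ (t : ℂ) (w : ℍ[ℂ]) : (unitVec t w).imJ = w.imJ / t := rfl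
@[simp] theorem unitVec_imK (t : ℂ) (w : ℍ[ℂ]) : (unitVec t w).imK = w.imK / t := rfl

theorem vecNorm_unitVec {t : ℂ} {w : ℍ[ℂ]} (ht : t ^ 2 = vecNorm w) (h0 : vecNorm w ≠ 0) :
    vecNorm (unitVec t w) = 1 := by
  have ht0 : t ^ 2 ≠ 0 := by rwa [ht]
  simp only [vecNorm, unitVec_imI, unitVec_imJ, unitVec_imK, div_pow, ← add_div]
  rw [← vecNorm, ← ht, div_self ht0]

/-- With `V` the vector part of `J`, `V ^ 2 = -1`, so `(1 - i V) / 2` and `(1 + i V) / 2` are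
complementary orthogonal idempotents, with coefficients `a` and `b` in `mix J a b`. -/
theorem mix_mul {J : ℍ[ℂ]} (hJ : vecNorm J = 1) (a b c d : ℂ) :
    mix J a b * mix J c d = mix J (a * c) (b * d) := by
  have hI := Complex.I_sq
  unfold vecNorm at hJ
  ext <;> simp only [Quaternion.re_mul, Quaternion.imI_mul, Quaternion.imJ_mul,
    Quaternion.imK_mul, mix_re, mix_imI, mix_imJ, mix_imK]
  · linear_combination (-(Complex.I ^ 2) * (a - b) * (c - d) / 4) * hJ -
      (a - b) * (c - d) / 4 * hI
  all_goals ring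

theorem mix_one (J : ℍ[ℂ]) : mix J 1 1 = 1 := by
  ext <;> simp

theorem mix_pow {J : ℍ[ℂ]} (hJ : vecNorm J = 1) (a b : ℂ) (k : ℕ) :
    mix J a b ^ k = mix J (a ^ k) (b ^ k) := by
  induction k with
  | zero => simp [mix_one]
  | succ k ih => rw [pow_succ, ih, mix_mul hJ, pow_succ, pow_succ]

theorem eigFst_mix {J : ℍ[ℂ]} (hJ : vecNorm J = 1) (a b : ℂ) : eigFst J (mix J a b) = a := by
  have hI := Complex.I_sq
  unfold vecNorm at hJ
  simp only [eigFst, vecDot, mix_re, mix_imI, mix_imJ, mix_imK]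
  linear_combination (-(Complex.I ^ 2) * (a - b) / 2) * hJ - (a - b) / 2 * hI

theorem eigSnd_mix {J : ℍ[ℂ]} (hJ : vecNorm J = 1) (a b : ℂ) : eigSnd J (mix J a b) = b := by
  have hI := Complex.I_sq
  unfold vecNorm at hJ
  simp only [eigSnd, vecDot, mix_re, mix_imI, mix_imJ, mix_imK]
  linear_combination ((Complex.I ^ 2) * (a - b) / 2) * hJ + (a - b) / 2 * hI

theorem mix_unitVec {t : ℂ} (ht : t ≠ 0) (w : ℍ[ℂ]) :
    mix (unitVec t w) (w.re + Complex.I * t) (w.re - Complex.I * t) = w := by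
  have hI := Complex.I_sq
  ext <;> simp only [mix_re, mix_imI, mix_imJ, mix_imK, unitVec_imI, unitVec_imJ, unitVec_imK] <;>
    field_simp
  · ring
  · linear_combination (-2 * t * w.imI) * hI
  · linear_combination (-2 * t * w.imJ) * hI
  · linear_combination (-2 * t * w.imK) * hI

/-- Commuting quaternions have parallel vector parts. -/
theorem parallel_of_commute {R : Type*} [Field R] [NeZero (2 : R)] {u w : ℍ[R]}
    (h : Commute u w) :
    w.imJ * u.imK = w.imK * u.imJ ∧ w.imK * u.imI = w.imI * u.imK ∧
      w.imI * u.imJ = w.imJ * u.imI := by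
  have h2 : (2 : R) ≠ 0 := NeZero.ne 2
  have h1 := congrArg QuaternionAlgebra.imI h.eq
  have h2' := congrArg QuaternionAlgebra.imJ h.eq
  have h3 := congrArg QuaternionAlgebra.imK h.eq
  simp only [Quaternion.imI_mul, Quaternion.imJ_mul, Quaternion.imK_mul] at h1 h2' h3
  refine ⟨?_, ?_, ?_⟩ <;> apply mul_left_cancel₀ h2
  · linear_combination -h1
  · linear_combination -h2'
  · linear_combination -h3

/-- An element commuting with `w` has vector part parallel to that of `w`, so it lies in `ℂ[J]` and
is recovered from its eigenvalues. -/
theorem mix_eig {t : ℂ} {u w : ℍ[ℂ]} (ht : t ^ 2 = vecNorm w) (h0 : vecNorm w ≠ 0)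
    (h : Commute u w) : mix (unitVec t w) (eigFst (unitVec t w) u) (eigSnd (unitVec t w) u) = u := by
  have ht0 : t ≠ 0 := by
    rintro rfl
    exact h0 (by rw [← ht]; ring)
  obtain ⟨h1, h2, h3⟩ := parallel_of_commute h
  have hI := Complex.I_sq
  unfold vecNorm at ht
  ext <;> simp only [mix_re, mix_imI, mix_imJ, mix_imK, unitVec_imI, unitVec_imJ, unitVec_imK,
    eigFst, eigSnd, vecDot] <;> field_simp
  · ring
  -- Coordinates of `w × (w × u) = (w · u) w - (w · w) u` for the vector parts, where `w × u = 0` by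
  -- `h1`, `h2`, `h3`.
  · linear_combination (-2 * w.imI * (w.imI * u.imI + w.imJ * u.imJ + w.imK * u.imK)) * hI
      - 2 * u.imI * ht + 2 * w.imJ * h3 - 2 * w.imK * h2
  · linear_combination (-2 * w.imJ * (w.imI * u.imI + w.imJ * u.imJ + w.imK * u.imK)) * hI
      - 2 * u.imJ * ht + 2 * w.imK * h1 - 2 * w.imI * h3
  · linear_combination (-2 * w.imK * (w.imI * u.imI + w.imJ * u.imJ + w.imK * u.imK)) * hI
      - 2 * u.imK * ht + 2 * w.imI * h2 - 2 * w.imJ * h1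

theorem ne_zero_of_sq_eq_vecNorm {t : ℂ} {w : ℍ[ℂ]} (ht : t ^ 2 = vecNorm w) (hw : w ∈ Omega) :
    t ≠ 0 := by
  rintro rfl
  exact hw.1 (by rw [← ht]; ring)

theorem eig_ne_zero {t : ℂ} {w : ℍ[ℂ]} (ht : t ^ 2 = vecNorm w) (hw : w ∈ Omega) :
    w.re + Complex.I * t ≠ 0 ∧ w.re - Complex.I * t ≠ 0 := by
  rw [← mul_ne_zero_iff]
  have hI := Complex.I_sq
  have : (w.re + Complex.I * t) * (w.re - Complex.I * t) = w.re ^ 2 + vecNorm w := by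
    linear_combination ht - t ^ 2 * hI
  rw [this]
  exact hw.2.1

/-- A root `u` commutes with its power `w`, so `mix_eig` applies to it; the eigenvalues of `u ^ k`
and of `w` are then compared. -/
theorem eig_pow {t : ℂ} {u w : ℍ[ℂ]} {k : ℕ} (ht : t ^ 2 = vecNorm w) (hw : w ∈ Omega)
    (h : u ^ k = w) :
    eigFst (unitVec t w) u ^ k = w.re + Complex.I * t ∧
      eigSnd (unitVec t w) u ^ k = w.re - Complex.I * t := by
  have hJ := vecNorm_unitVec ht hw.1
  have hu := mix_eig ht hw.1 (h ▸ Commute.self_pow u k)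
  set J := unitVec t w
  have e1 : w = mix J (eigFst J u ^ k) (eigSnd J u ^ k) := by rw [← mix_pow hJ, hu, h]
  have e2 := mix_unitVec (ne_zero_of_sq_eq_vecNorm ht hw) w
  have e3 := e2.trans e1
  have f1 := congrArg (eigFst J) e3
  have f2 := congrArg (eigSnd J) e3
  rw [eigFst_mix hJ, eigFst_mix hJ] at f1
  rw [eigSnd_mix hJ, eigSnd_mix hJ] at f2
  exact ⟨f1.symm, f2.symm⟩

theorem mix_pow_eq {t a b : ℂ} {w : ℍ[ℂ]} {k : ℕ} (ht : t ^ 2 = vecNorm w) (hw : w ∈ Omega)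
    (ha : a ^ k = w.re + Complex.I * t) (hb : b ^ k = w.re - Complex.I * t) :
    mix (unitVec t w) a b ^ k = w := by
  rw [mix_pow (vecNorm_unitVec ht hw.1), ha, hb, mix_unitVec (ne_zero_of_sq_eq_vecNorm ht hw)]

theorem exists_pow_eq_of_mem_Omega {w : ℍ[ℂ]} (hw : w ∈ Omega) {k : ℕ} (hk : k ≠ 0) :
    ∃ u : ℍ[ℂ], u ^ k = w := by
  obtain ⟨t, ht⟩ := IsAlgClosed.exists_pow_nat_eq (vecNorm w) two_pos
  obtain ⟨a, ha⟩ := IsAlgClosed.exists_pow_nat_eq (w.re + Complex.I * t) (Nat.pos_of_ne_zero hk)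
  obtain ⟨b, hb⟩ := IsAlgClosed.exists_pow_nat_eq (w.re - Complex.I * t) (Nat.pos_of_ne_zero hk)
  exact ⟨_, mix_pow_eq ht hw ha hb⟩

/-! ### Lifts through the power maps -/

theorem exists_continuousOn_sqrt_vecNorm {D : Set ℂ} (hDo : IsOpen D) (hDs : IsSimplyConnected D)
    {F : ℂ → ℍ[ℂ]} (hFc : ContOn D F) (hΩ : ∀ z ∈ D, F z ∈ Omega) :
    ∃ t : ℂ → ℂ, ContinuousOn t D ∧ ∀ z, t z ^ 2 = vecNorm (F z) := by
  obtain ⟨-, h1, h2, h3⟩ := contOn_iff.mp hFc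
  have hs : ContinuousOn (fun z => vecNorm (F z)) D := by
    unfold vecNorm
    fun_prop
  exact Complex.exists_continuousOn_pow_eq hDs hDo hs
    (by rintro ⟨z, hz, h⟩; exact (hΩ z hz).1 h) two_ne_zero

theorem exists_isLift {D : Set ℂ} (hDo : IsOpen D) (hDs : IsSimplyConnected D)
    {k : ℕ} (hk : k ≠ 0) {F : ℂ → ℍ[ℂ]} (hFc : ContOn D F) (hΩ : ∀ z ∈ D, F z ∈ Omega)
    {x : ℂ} (hx : x ∈ D) {p : ℍ[ℂ]} (hp : p ^ k = F x) :
    ∃ G : ℂ → ℍ[ℂ], IsLift D k F G ∧ G x = p ∧ (HolOn D F → HolOn D G) := by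
  obtain ⟨t, htc, ht⟩ := exists_continuousOn_sqrt_vecNorm hDo hDs hFc hΩ
  have ht0 : ∀ z ∈ D, t z ≠ 0 := fun z hz => ne_zero_of_sq_eq_vecNorm (ht z) (hΩ z hz)
  obtain ⟨h0, h1, h2, h3⟩ := contOn_iff.mp hFc
  -- The eigenvalues of `p` serve as initial values at `x` for the continuous roots `u` and `v`.
  obtain ⟨ha, hb⟩ := eig_pow (ht x) (hΩ x hx) hp
  obtain ⟨u, huc, hu, hux⟩ := exists_continuousOn_root hDo hDs
    (a := fun z => (F z).re + Complex.I * t z) (by fun_prop)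
    (fun z hz => (eig_ne_zero (ht z) (hΩ z hz)).1) hk hx ha
  obtain ⟨v, hvc, hv, hvx⟩ := exists_continuousOn_root hDo hDs
    (a := fun z => (F z).re - Complex.I * t z) (by fun_prop)
    (fun z hz => (eig_ne_zero (ht z) (hΩ z hz)).2) hk hx hb
  refine ⟨fun z => mix (unitVec (t z) (F z)) (u z) (v z), ⟨?_, fun z hz => ?_⟩, ?_, fun hF => ?_⟩
  · rw [contOn_iff]
    simp only [mix_re, mix_imI, mix_imJ, mix_imK, unitVec_imI, unitVec_imJ, unitVec_imK]
    refine ⟨by fun_prop, ?_, ?_, ?_⟩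
    · exact ContinuousOn.mul (by fun_prop) (h1.div htc ht0)
    · exact ContinuousOn.mul (by fun_prop) (h2.div htc ht0)
    · exact ContinuousOn.mul (by fun_prop) (h3.div htc ht0)
  · exact mix_pow_eq (ht z) (hΩ z hz) (hu z) (hv z)
  · simp only [hux, hvx]
    exact mix_eig (ht x) (hΩ x hx).1 (hp ▸ Commute.self_pow p k)
  · obtain ⟨d0, d1, d2, d3⟩ := holOn_iff.mp hF
    have dt : DifferentiableOn ℂ t D :=
      differentiableOn_of_pow hDo htc two_ne_zero (fun z _ => ht z)
        (by unfold vecNorm; fun_prop) fun z hz => (hΩ z hz).1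
    have du : DifferentiableOn ℂ u D :=
      differentiableOn_of_pow hDo huc hk (fun z _ => hu z) (by fun_prop)
        fun z hz => (eig_ne_zero (ht z) (hΩ z hz)).1
    have dv : DifferentiableOn ℂ v D :=
      differentiableOn_of_pow hDo hvc hk (fun z _ => hv z) (by fun_prop)
        fun z hz => (eig_ne_zero (ht z) (hΩ z hz)).2
    rw [holOn_iff]
    simp only [mix_re, mix_imI, mix_imJ, mix_imK, unitVec_imI, unitVec_imJ, unitVec_imK]
    refine ⟨by fun_prop, ?_, ?_, ?_⟩
    · exact DifferentiableOn.mul (by fun_prop) (d1.div dt ht0)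
    · exact DifferentiableOn.mul (by fun_prop) (d2.div dt ht0)
    · exact DifferentiableOn.mul (by fun_prop) (d3.div dt ht0)

/-- One choice of `t` serves both lifts, so their eigenvalues are continuous roots of the same
nonvanishing functions and agree at `x`. -/
theorem IsLift.eqOn {D : Set ℂ} (hDo : IsOpen D) (hDs : IsSimplyConnected D)
    {k : ℕ} (hk : k ≠ 0) {F G H : ℂ → ℍ[ℂ]} (hFc : ContOn D F) (hΩ : ∀ z ∈ D, F z ∈ Omega)
    (hG : IsLift D k F G) (hH : IsLift D k F H) {x : ℂ} (hx : x ∈ D) (hxe : G x = H x) :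
    Set.EqOn G H D := by
  obtain ⟨t, htc, ht⟩ := exists_continuousOn_sqrt_vecNorm hDo hDs hFc hΩ
  have ht0 : ∀ z ∈ D, t z ≠ 0 := fun z hz => ne_zero_of_sq_eq_vecNorm (ht z) (hΩ z hz)
  have hconn : IsPreconnected D := hDs.isPathConnected.isConnected.isPreconnected
  have hdot : ∀ G, IsLift D k F G →
      ContinuousOn (fun z => eigFst (unitVec (t z) (F z)) (G z)) D ∧
      ContinuousOn (fun z => eigSnd (unitVec (t z) (F z)) (G z)) D := by
    intro G hG
    obtain ⟨-, h1, h2, h3⟩ := contOn_iff.mp hFc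
    obtain ⟨g0, g1, g2, g3⟩ := contOn_iff.mp hG.1
    have : ContinuousOn (fun z => vecDot (unitVec (t z) (F z)) (G z)) D :=
      (((h1.div htc ht0).mul g1).add ((h2.div htc ht0).mul g2)).add ((h3.div htc ht0).mul g3)
    unfold eigFst eigSnd
    exact ⟨by fun_prop, by fun_prop⟩
  have hpow : ∀ G, IsLift D k F G → ∀ z ∈ D, _ := fun G hG z hz =>
    eig_pow (ht z) (hΩ z hz) (hG.2 z hz)
  have e1 : Set.EqOn (fun z => eigFst (unitVec (t z) (F z)) (G z))
      (fun z => eigFst (unitVec (t z) (F z)) (H z)) D := by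
    refine eqOn_of_pow_eq hconn (hdot G hG).1 (hdot H hH).1 hk
      (fun z hz => (hpow G hG z hz).1.trans (hpow H hH z hz).1.symm) (fun z hz h => ?_) hx
      (by simp only [hxe])
    apply (eig_ne_zero (ht z) (hΩ z hz)).1
    rw [← (hpow H hH z hz).1]
    simp only [h, zero_pow hk]
  have e2 : Set.EqOn (fun z => eigSnd (unitVec (t z) (F z)) (G z))
      (fun z => eigSnd (unitVec (t z) (F z)) (H z)) D := by
    refine eqOn_of_pow_eq hconn (hdot G hG).2 (hdot H hH).2 hk
      (fun z hz => (hpow G hG z hz).2.trans (hpow H hH z hz).2.symm) (fun z hz h => ?_) hx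
      (by simp only [hxe])
    apply (eig_ne_zero (ht z) (hΩ z hz)).2
    rw [← (hpow H hH z hz).2]
    simp only [h, zero_pow hk]
  intro z hz
  have hcomm : ∀ G, IsLift D k F G → Commute (G z) (F z) := fun G hG =>
    hG.2 z hz ▸ Commute.self_pow (G z) k
  rw [← mix_eig (ht z) (hΩ z hz).1 (hcomm G hG), ← mix_eig (ht z) (hΩ z hz).1 (hcomm H hH)]
  exact congrArg₂ _ (e1 hz) (e2 hz)

/-! ### Conjugation and real points -/

theorem cconj_mul (v w : ℍ[ℂ]) : cconj (v * w) = cconj v * cconj w := by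
  ext <;> simp

theorem cconj_pow (w : ℍ[ℂ]) (k : ℕ) : cconj (w ^ k) = cconj w ^ k := by
  induction k with
  | zero => ext <;> simp
  | succ k ih => rw [pow_succ, cconj_mul, ih, pow_succ]

theorem cconj_cconj (w : ℍ[ℂ]) : cconj (cconj w) = w := by
  ext <;> simp

@[simp] theorem ofQuat_re (p : ℍ[ℝ]) : (ofQuat p).re = p.re := rfl
@[simp] theorem ofQuat_imI (p : ℍ[ℝ]) : (ofQuat p).imI = p.imI := rfl
@[simp] theorem ofQuat_imJ (p : ℍ[ℝ]) : (ofQuat p).imJ = p.imJ := rfl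
@[simp] theorem ofQuat_imK (p : ℍ[ℝ]) : (ofQuat p).imK = p.imK := rfl

theorem cconj_ofQuat (p : ℍ[ℝ]) : cconj (ofQuat p) = ofQuat p := by
  ext <;> simp

theorem rePart_ofQuat (p : ℍ[ℝ]) : rePart (ofQuat p) = p := by
  ext <;> simp

theorem ofQuat_injective : Function.Injective ofQuat :=
  Function.LeftInverse.injective rePart_ofQuat

theorem ofQuat_mul (p q : ℍ[ℝ]) : ofQuat (p * q) = ofQuat p * ofQuat q := by
  ext <;> simp

theorem ofQuat_pow (p : ℍ[ℝ]) (k : ℕ) : ofQuat (p ^ k) = ofQuat p ^ k := by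
  induction k with
  | zero => ext <;> simp
  | succ k ih => rw [pow_succ, ofQuat_mul, ih, pow_succ]

theorem eq_ofQuat_of_cconj_eq {w : ℍ[ℂ]} (h : cconj w = w) : w = ofQuat (rePart w) := by
  have h0 := congrArg QuaternionAlgebra.re h
  have h1 := congrArg QuaternionAlgebra.imI h
  have h2 := congrArg QuaternionAlgebra.imJ h
  have h3 := congrArg QuaternionAlgebra.imK h
  simp only [cconj_re, cconj_imI, cconj_imJ, cconj_imK, Complex.conj_eq_iff_re] at h0 h1 h2 h3
  exact Quaternion.ext _ _ h0.symm h1.symm h2.symm h3.symm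

theorem IsStem.eq_ofQuat {D : Set ℂ} {F : ℂ → ℍ[ℂ]} (hF : IsStem D F) {z : ℂ} (hz : z ∈ D)
    (h0 : z.im = 0) : F z = ofQuat (rePart (F z)) := by
  refine eq_ofQuat_of_cconj_eq ?_
  rw [← (hF z hz).2, Complex.conj_eq_iff_im.mpr h0]

/-- A quaternion that is not real has exactly `k` roots of order `k`. -/
theorem exists_roots_quaternion {q₀ : ℍ[ℝ]} (h0 : q₀.imI ^ 2 + q₀.imJ ^ 2 + q₀.imK ^ 2 ≠ 0)
    {k : ℕ} (hk : k ≠ 0) :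
    ∃ q : Fin k → ℍ[ℝ], Function.Injective q ∧ Set.range q = {p : ℍ[ℝ] | p ^ k = q₀} := by
  obtain ⟨y, hy⟩ : ∃ y : ℝ, y ^ 2 = q₀.imI ^ 2 + q₀.imJ ^ 2 + q₀.imK ^ 2 :=
    ⟨_, Real.sq_sqrt (by positivity)⟩
  have hy0 : y ≠ 0 := by
    rintro rfl
    exact h0 (by rw [← hy]; ring)
  obtain ⟨J, j0, j1, j2, j3⟩ : ∃ J : ℍ[ℝ], J.re = 0 ∧ J.imI = q₀.imI / y ∧ J.imJ = q₀.imJ / y ∧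
      J.imK = q₀.imK / y := ⟨⟨0, q₀.imI / y, q₀.imJ / y, q₀.imK / y⟩, rfl, rfl, rfl, rfl⟩
  have hJ : J * J = -1 := by
    ext <;> simp [j0, j1, j2, j3]
    · field_simp
      linear_combination hy
    all_goals ring
  -- An isomorphism of `ℂ` onto `ℝ[J]`, the plane containing `q₀` and, by commutation, all its
  -- roots.
  set φ : ℂ →ₐ[ℝ] ℍ[ℝ] := Complex.lift ⟨J, hJ⟩ with hφ
  have φ_apply : ∀ c d : ℝ, φ ⟨c, d⟩ = (c : ℍ[ℝ]) + d • J := by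
    intro c d
    rw [hφ, Complex.lift_apply, Complex.liftAux_apply]
    rfl
  have φ_inj : Function.Injective φ := φ.toRingHom.injective
  have hq₀ : φ ⟨q₀.re, y⟩ = q₀ := by
    rw [φ_apply]
    ext <;> simp [j0, j1, j2, j3] <;> field_simp
  have φ_surj : ∀ p : ℍ[ℝ], Commute p q₀ → ∃ c, φ c = p := by
    intro p hp
    obtain ⟨h1, h2, h3⟩ := parallel_of_commute hp
    refine ⟨⟨p.re, (q₀.imI * p.imI + q₀.imJ * p.imJ + q₀.imK * p.imK) / y⟩, ?_⟩
    rw [φ_apply]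
    ext <;> simp [j0, j1, j2, j3] <;> field_simp
    · linear_combination -p.imI * hy + q₀.imJ * h3 - q₀.imK * h2
    · linear_combination -p.imJ * hy + q₀.imK * h1 - q₀.imI * h3
    · linear_combination -p.imK * hy + q₀.imI * h2 - q₀.imJ * h1
  set a : ℂ := ⟨q₀.re, y⟩ with ha
  have ha0 : a ≠ 0 := fun h => hy0 (congrArg Complex.im h)
  have hprim := Complex.isPrimitiveRoot_exp k hk
  obtain ⟨α, hα⟩ := IsAlgClosed.exists_pow_nat_eq a (Nat.pos_of_ne_zero hk)
  have hcard : (Polynomial.nthRootsFinset k a).card = k := by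
    classical
    rw [Polynomial.nthRootsFinset, ← Multiset.toFinset_eq (hprim.nthRoots_nodup ha0),
      Finset.card_mk, hprim.card_nthRoots, if_pos ⟨α, hα⟩]
  let e := (Polynomial.nthRootsFinset k a).equivFinOfCardEq hcard
  refine ⟨fun m => φ (e.symm m), fun m n h => e.symm.injective (Subtype.ext (φ_inj h)), ?_⟩
  ext p
  constructor
  · rintro ⟨m, rfl⟩
    have := (Polynomial.mem_nthRootsFinset (Nat.pos_of_ne_zero hk) _).mp (e.symm m).2
    change φ _ ^ k = q₀
    rw [← map_pow, this, hq₀]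
  · intro hp
    obtain ⟨c, rfl⟩ := φ_surj p ((show p ^ k = q₀ from hp) ▸ Commute.self_pow p k)
    have hc : c ^ k = a := φ_inj (by rw [map_pow, hq₀]; exact hp)
    refine ⟨e ⟨c, (Polynomial.mem_nthRootsFinset (Nat.pos_of_ne_zero hk) _).mpr hc⟩, ?_⟩
    simp

theorem exists_roots_at_real {D : Set ℂ} {F : ℂ → ℍ[ℂ]} (hF : IsStem D F)
    (hΩ : ∀ z ∈ D, F z ∈ Omega) {k : ℕ} (hk : k ≠ 0) {z : ℂ} (hz : z ∈ D) (h0 : z.im = 0) :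
    ∃ q : Fin k → ℍ[ℝ], Function.Injective q ∧
      Set.range q = {p : ℍ[ℝ] | p ^ k = rePart (F z)} := by
  refine exists_roots_quaternion (fun h => ?_) hk
  have hv := (hΩ z hz).1
  rw [hF.eq_ofQuat hz h0] at hv
  apply hv
  simp only [vecNorm, ofQuat_imI, ofQuat_imJ, ofQuat_imK]
  exact_mod_cast h

/-- Reflection preserves lifts of a stem function; by uniqueness, a lift that is real at one real
point will be its own reflection. -/
theorem IsLift.cconj {D : Set ℂ} {k : ℕ} {F G : ℂ → ℍ[ℂ]} (hF : IsStem D F)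
    (hG : IsLift D k F G) : IsLift D k F (fun z => cconj (G (starRingEnd ℂ z))) := by
  constructor
  · obtain ⟨h0, h1, h2, h3⟩ := contOn_iff.mp hG.1
    have hc : ContinuousOn (starRingEnd ℂ) D := Complex.continuous_conj.continuousOn
    have hm : Set.MapsTo (starRingEnd ℂ) D D := fun z hz => (hF z hz).1
    exact contOn_iff.mpr ⟨Complex.continuous_conj.comp_continuousOn (h0.comp hc hm),
      Complex.continuous_conj.comp_continuousOn (h1.comp hc hm),
      Complex.continuous_conj.comp_continuousOn (h2.comp hc hm),
      Complex.continuous_conj.comp_continuousOn (h3.comp hc hm)⟩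
  · intro z hz
    have h := hG.2 _ (hF z hz).1
    unfold sigma at h ⊢
    rw [← cconj_pow, h, (hF z hz).2, cconj_cconj]

theorem starPow_eq {D : Set ℂ} {k : ℕ} {F G : ℂ → ℍ[ℂ]} {f g : circ D → ℍ[ℝ]}
    (hf : Induces D F f) (hG : IsStem D G) (hg : Induces D G g)
    (h : ∀ z ∈ D, sigma k (G z) = F z) : starPow D g k = f :=
  ((induces_starPow hG hg k).2.congr h).unique hf

/-- A stem function with values in `Ω` has `k` distinct stem roots of order `k`. -/
theorem exists_stem_roots {D : Set ℂ} {k : ℕ} (hk : k ≠ 0) {F : ℂ → ℍ[ℂ]} (hF : IsStem D F)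
    (hΩ : ∀ z ∈ D, F z ∈ Omega) :
    ∃ G : Fin k → ℂ → ℍ[ℂ], (∀ m, IsStem D (G m) ∧ ∀ z ∈ D, sigma k (G m z) = F z) ∧
      ∀ z ∈ D, z.im = 0 → Function.Injective fun m => G m z := by
  -- Stated for every `z`, with a dummy value off the real points of `D`, so that `choose` gives a
  -- total function.
  have hreal : ∀ z : ℂ, ∃ q : Fin k → ℍ[ℝ], z ∈ D → z.im = 0 → Function.Injective q ∧
      Set.range q = {p : ℍ[ℝ] | p ^ k = rePart (F z)} := by
    intro z
    by_cases h : z ∈ D ∧ z.im = 0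
    · obtain ⟨q, hq⟩ := exists_roots_at_real hF hΩ hk h.1 h.2
      exact ⟨q, fun _ _ => hq⟩
    · exact ⟨0, fun h1 h2 => absurd ⟨h1, h2⟩ h⟩
  choose q hq using hreal
  have hroot : ∀ z : ℂ, ∃ u : ℍ[ℂ], z ∈ D → u ^ k = F z := by
    intro z
    by_cases h : z ∈ D
    · obtain ⟨u, hu⟩ := exists_pow_eq_of_mem_Omega (hΩ z h) hk
      exact ⟨u, fun _ => hu⟩
    · exact ⟨0, fun h' => absurd h' h⟩
  choose r hr using hroot
  -- The index `m` matters only on the real axis, which is enough for distinctness. In the upper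
  -- half-plane any root is allowed, and the lower half-plane is then forced by symmetry.
  refine ⟨fun m z => if z.im = 0 then ofQuat (q z m) else if 0 < z.im then r z else
    cconj (r (starRingEnd ℂ z)), fun m => ⟨fun z hz => ⟨(hF z hz).1, ?_⟩, fun z hz => ?_⟩, ?_⟩
  · simp only [Complex.conj_im, neg_eq_zero, Left.neg_pos_iff, Complex.conj_conj]
    rcases lt_trichotomy z.im 0 with h | h | h
    · simp [h.ne, h, h.not_gt, cconj_cconj]
    · simp [h, cconj_ofQuat, Complex.conj_eq_iff_im.mpr h]
    · simp [h.ne', h, h.not_gt]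
  · unfold sigma
    simp only
    split_ifs with h1 h2
    · have := (hq z hz h1).2
      have hm : q z m ∈ Set.range (q z) := ⟨m, rfl⟩
      rw [this] at hm
      rw [← ofQuat_pow, show q z m ^ k = _ from hm, ← hF.eq_ofQuat hz h1]
    · exact hr z hz
    · rw [← cconj_pow, hr _ (hF z hz).1, (hF z hz).2, cconj_cconj]
  · intro z hz h0 m n h
    simp only [h0, if_true] at h
    exact (hq z hz h0).1 (ofQuat_injective h)

end SliceRoots

end

/-! ### The `⋆`-roots of a slice function -/

open SliceRoots
theorem mainTheorem4
    (D : Set ℂ) (hDo : IsOpen D) (hDs : IsSimplyConnected D)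
    (hDr : ∃ x : ℝ, (x : ℂ) ∈ D)
    (k : ℕ) (hk : 1 ≤ k)
    (F : ℂ → ℍ[ℂ]) (f : circ D → ℍ[ℝ])
    (hF : IsStem D F) (hf : Induces D F f)
    (hΩ : ∀ z ∈ D, F z ∈ Omega) :
    -- every slice function as above has `k` distinct `k`-th roots
    (∃ g : Fin k → (circ D → ℍ[ℝ]), Function.Injective g ∧
      ∀ m, IsSlice D (g m) ∧ starPow D (g m) k = f) ∧
    -- if `F` is continuous, such roots are the lifts of `F` that start at the `k` real
    -- quaternionic roots of `F x₀`
    (ContOn D F → ∀ x₀ : ℝ, (x₀ : ℂ) ∈ D →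
      ∃ (q₀ : ℍ[ℝ]) (q : Fin k → ℍ[ℝ]),
        F x₀ = ofQuat q₀ ∧
        Function.Injective q ∧ Set.range q = {p : ℍ[ℝ] | p ^ k = q₀} ∧
        ∃ (G : Fin k → ℂ → ℍ[ℂ]) (g : Fin k → (circ D → ℍ[ℝ])),
          Function.Injective g ∧
          ∀ m,
            (IsLift D k F (G m) ∧ G m x₀ = ofQuat (q m)) ∧
            (∀ H : ℂ → ℍ[ℂ], IsLift D k F H →
              H x₀ = ofQuat (q m) → Set.EqOn H (G m) D) ∧
            IsStem D (G m) ∧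
            Induces D (G m) (g m) ∧
            starPow D (g m) k = f ∧
            (IsSliceRegular D f →
              HolOn D (G m) ∧ IsSliceRegular D (g m))) ∧
    -- if `f` is slice regular, it has `k` distinct slice regular `k`-th roots
    (IsSliceRegular D f →
      ∃ g : Fin k → (circ D → ℍ[ℝ]), Function.Injective g ∧
        ∀ m, IsSliceRegular D (g m) ∧ starPow D (g m) k = f) := by
  have hk0 : k ≠ 0 := Nat.one_le_iff_ne_zero.mp hk
  have lifts : ContOn D F → ∀ x₀ : ℝ, (x₀ : ℂ) ∈ D →
      ∃ (q₀ : ℍ[ℝ]) (q : Fin k → ℍ[ℝ]),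
        F x₀ = ofQuat q₀ ∧
        Function.Injective q ∧ Set.range q = {p : ℍ[ℝ] | p ^ k = q₀} ∧
        ∃ (G : Fin k → ℂ → ℍ[ℂ]) (g : Fin k → (circ D → ℍ[ℝ])),
          Function.Injective g ∧
          ∀ m,
            (IsLift D k F (G m) ∧ G m x₀ = ofQuat (q m)) ∧
            (∀ H : ℂ → ℍ[ℂ], IsLift D k F H →
              H x₀ = ofQuat (q m) → Set.EqOn H (G m) D) ∧
            IsStem D (G m) ∧
            Induces D (G m) (g m) ∧
            starPow D (g m) k = f ∧
            (IsSliceRegular D f →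
              HolOn D (G m) ∧ IsSliceRegular D (g m)) := by
    intro hFc x₀ hx₀
    have hFx := hF.eq_ofQuat hx₀ (Complex.ofReal_im x₀)
    obtain ⟨q, hqi, hqr⟩ := exists_roots_at_real hF hΩ hk0 hx₀ (Complex.ofReal_im x₀)
    have hpow : ∀ m, ofQuat (q m) ^ k = F x₀ := by
      intro m
      have hm : q m ∈ Set.range q := ⟨m, rfl⟩
      rw [hqr] at hm
      rw [← ofQuat_pow, show q m ^ k = _ from hm, ← hFx]
    choose G hG hGx hGh using fun m => exists_isLift hDo hDs hk0 hFc hΩ hx₀ (hpow m)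
    have hstem : ∀ m, IsStem D (G m) := by
      intro m z hz
      refine ⟨(hF z hz).1, ?_⟩
      -- The lift and its reflection agree at `x₀`, where the value `ofQuat (q m)` is fixed by
      -- `cconj`.
      have := (hG m).eqOn hDo hDs hk0 hFc hΩ ((hG m).cconj hF) hx₀
        (by rw [Complex.conj_ofReal, hGx, cconj_ofQuat])
      rw [this hz, cconj_cconj]
    have hind := fun m => induces_sliceFn (hstem m)
    refine ⟨_, q, hFx, hqi, hqr, G, fun m => sliceFn D (G m), fun m n h => ?_, fun m =>
      ⟨⟨hG m, hGx m⟩, fun H hH hHx => hH.eqOn hDo hDs hk0 hFc hΩ (hG m) hx₀ (by rw [hHx, hGx]),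
        hstem m, hind m, starPow_eq hf (hstem m) (hind m) (hG m).2, ?_⟩⟩
    -- Equal slice functions would have equal stem functions, whose values at `x₀` are the distinct
    -- roots `q m` and `q n`.
    · have hn : Induces D (G n) (sliceFn D (G m)) := by
        rw [show sliceFn D (G m) = sliceFn D (G n) from h]
        exact hind n
      have := stem_unique (hind m) hn hx₀
      rw [hGx, hGx] at this
      exact hqi (ofQuat_injective this)
    -- Regularity of `f` only provides some holomorphic stem function; by uniqueness it equals `F`
    -- on `D`.
    · rintro ⟨F', -, hF', hfF'⟩
      have := hGh m (hF'.congr (stem_unique hfF' hf))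
      exact ⟨this, G m, hstem m, this, hind m⟩
  obtain ⟨x, hx⟩ := hDr
  refine ⟨?_, lifts, fun hreg => ?_⟩
  · obtain ⟨G, hG, hinj⟩ := exists_stem_roots hk0 hF hΩ
    have hind := fun m => induces_sliceFn (hG m).1
    refine ⟨fun m => sliceFn D (G m), fun m n h => ?_, fun m =>
      ⟨⟨G m, (hG m).1, hind m⟩, starPow_eq hf (hG m).1 (hind m) (hG m).2⟩⟩
    have hn : Induces D (G n) (sliceFn D (G m)) := by
      rw [show sliceFn D (G m) = sliceFn D (G n) from h]
      exact hind n
    exact hinj x hx (Complex.ofReal_im x) (stem_unique (hind m) hn hx)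
  · obtain ⟨F', -, hF', hfF'⟩ := id hreg
    obtain ⟨_, _, _, _, _, G, g, hg, h⟩ := lifts (hF'.congr (stem_unique hfF' hf)).contOn x hx
    exact ⟨g, hg, fun m => ⟨((h m).2.2.2.2.2 hreg).2, (h m).2.2.2.2.1⟩⟩
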